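/- Let $S^3=\{(x_1,y_1,x_2,y_2)\in\mathbb R^4: x_1^2+y_1^2+x_2^2+y_2^2=1\}$, write $z=x_1+iy_1$ and $w=x_2+iy_2$ for the complex coordinates on it, and let $d\mathrm{Vol}$ be the Riemannian volume of the round metric on $S^3$, normalized so that $\mathrm{Vol}(S^3)=1$; $L^2(S^3)$ is taken with respect to $d\mathrm{Vol}$. The Rudin–Shapiro polynomials are defined by $P_0=Q_0=1$ and $$P_{m+1}(t)=P_m(t)+e^{i2^mt}Q_m(t),\qquad Q_{m+1}(t)=P_m(t)-e^{i2^mt}Q_m(t)\qquad(m\ge 0);$$ both $P_m$ and $Q_m$ are of the form $\sum_{j=0}^{2^m-1}\epsilon_je^{ijt}$ with $\epsilon_j\in\{1,-1\}$. For $N\ge0$, a Rudin–Shapiro sequence $\{\sigma_j\}_{j=0}^N$ consists of the first $N+1$ coefficients of $P_m$ or of $Q_m$ for some $m$ with $2^m>N$. Given such a sequence for each $N$, and $0\le k\le N$, Bourgain's spherical harmonics are $$P_{N,k}(z,w)=\frac{1}{\sqrt{N+1}}\sum_{j=0}^N\sigma_j\,e^{\frac{2\pi ijk}{N+1}}\,\frac{z^jw^{N-j}}{\|z^jw^{N-j}\|_{L^2(S^3)}}.$$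 **Theorem (equidistribution of spherical harmonics by Bourgain).** For every $f\in C^\infty(S^3)$ (complex-valued), every choice of a Rudin–Shapiro sequence $\{\sigma_j\}_{j=0}^N$ for each $N$, and every choice of indices $k=k(N)\in\{0,\dots,N\}$, $$\lim_{N\to\infty}\int_{S^3}f\,|P_{N,k(N)}|^2\,d\mathrm{Vol}=\int_{S^3}f\,d\mathrm{Vol}.$$ -/

import Mathlib

open MeasureTheory Filter Topology
open scoped Manifold ContDiff Polynomial

noncomputable section

/-- The unit sphere `S³ = {(x₁, y₁, x₂, y₂) : x₁² + y₁² + x₂² + y₂² = 1}` in `ℝ⁴`. -/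
abbrev S3 : Type := Metric.sphere (0 : EuclideanSpace ℝ (Fin 4)) 1

namespace S3

/-- The complex coordinate `z = x₁ + i y₁`. -/
def z (q : S3) : ℂ := ⟨q.1 0, q.1 1⟩

/-- The complex coordinate `w = x₂ + i y₂`. -/
def w (q : S3) : ℂ := ⟨q.1 2, q.1 3⟩

/-- The Riemannian volume (surface measure) of the round sphere `S³`, normalized to total
mass one. -/
def vol : Measure S3 :=
  ((volume : Measure (EuclideanSpace ℝ (Fin 4))).toSphere Set.univ)⁻¹ •
    (volume : Measure (EuclideanSpace ℝ (Fin 4))).toSphere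

/-- The norm of `g` in `L²(S³)` with respect to the normalized volume. -/
def l2norm (g : S3 → ℂ) : ℝ := Real.sqrt (∫ q, ‖g q‖ ^ 2 ∂vol)

end S3

/-- The pair of Rudin-Shapiro polynomials `(P_m, Q_m)`, where the variable `X` stands for
`e^{it}`: `P_0 = Q_0 = 1`, `P_{m+1} = P_m + X^(2^m) Q_m`, `Q_{m+1} = P_m - X^(2^m) Q_m`. Both
have degree `2^m - 1` and coefficients `±1`. -/
def rudinShapiroPair : ℕ → ℤ[X] × ℤ[X]
  | 0 => (1, 1)
  | m + 1 =>
    ((rudinShapiroPair m).1 + Polynomial.X ^ (2 ^ m) * (rudinShapiroPair m).2,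
      (rudinShapiroPair m).1 - Polynomial.X ^ (2 ^ m) * (rudinShapiroPair m).2)

/-- `σ 0, …, σ N` is a Rudin-Shapiro sequence: it consists of the first `N + 1` coefficients of a
Rudin-Shapiro polynomial `P_m`, or of a Rudin-Shapiro polynomial `Q_m`, having at least `N + 1`
coefficients. (The values `σ j` with `j > N` are irrelevant.) -/
def IsRudinShapiro (N : ℕ) (σ : ℕ → ℤ) : Prop :=
  ∃ m : ℕ, N < 2 ^ m ∧
    ((∀ j ≤ N, σ j = (rudinShapiroPair m).1.coeff j) ∨
      (∀ j ≤ N, σ j = (rudinShapiroPair m).2.coeff j))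

/-- Bourgain's spherical harmonic `P_{N,k}` on `S³` built from the signs `σ 0, …, σ N`:
`(N+1)^(-1/2) ∑_{j=0}^N σ_j e^{2πijk/(N+1)} z^j w^(N-j) / ‖z^j w^(N-j)‖_{L²(S³)}`. -/
def bourgainHarmonic (σ : ℕ → ℤ) (N k : ℕ) (q : S3) : ℂ :=
  1 / (Real.sqrt ((N : ℝ) + 1) : ℂ) *
    ∑ j ∈ Finset.range (N + 1),
      (σ j : ℂ) * Complex.exp (2 * Real.pi * Complex.I * j * k / (N + 1)) *
        ((S3.z q ^ j * S3.w q ^ (N - j)) /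
          (S3.l2norm (fun p => S3.z p ^ j * S3.w p ^ (N - j)) : ℂ))

end

/-! Continuous functions on the sphere are uniform limits of combinations of monomials `z^a z̄^b w^c
w̄^d` (Stone–Weierstrass), and `|P_{N,k}|²` has integral one, so it suffices to test against
monomials. Expanding `|P_{N,k}|²` as a double sum over `j, l`, orthogonality of monomials keeps only
the pairs with `l - j = a - b`. If `a = b`, the surviving part of `|P_{N,k}|²` is `∑ (N choose j)
|z|^(2j) |w|^(2(N-j)) = 1`, so the integral is already exact
(`integral_diagonal_mul_bourgainHarmonic`). If `a + c ≠ b + d`, both sides vanish. Otherwise, up to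
conjugation, `a - b = r > 0`. The Fourier phases then combine to a factor independent of `j`, so `k`
plays no role, and what is left is a weighted autocorrelation `∑ σ_j σ_{j+r}`. The weight is an
increasing factor times a decreasing one, so summation by parts (`abs_sum_mul_mul_reflect_le`)
reduces to unweighted partial sums. These are `O(log N)`: the relations for `a(2n)` and `a(2n+1)`
express the autocorrelation at `2n` through those at `n`, with shift about half as large
(`logBounded_rsCorr_rsAltCorr`). The weights are normalized to be bounded, and the prefactor
`1/(N+1)` leaves `O(log N / N)`. -/

/-! ### Monomial integrals over the sphere, by Gaussian integration -/

/-- The mixed monomial `x^a (star x)^b y^c (star y)^d`. -/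
def mixedMonomial (a b c d : ℕ) (x y : ℂ) : ℂ :=
  x ^ a * star x ^ b * (y ^ c * star y ^ d)

theorem integral_pow_mul_star_pow_mul_exp (a b : ℕ) :
    ∫ x : ℂ, x ^ a * star x ^ b * (Real.exp (-‖x‖ ^ 2) : ℂ) =
      if a = b then (Real.pi * a.factorial : ℂ) else 0 := by
  split_ifs with h
  · subst h
    have h1 := Complex.integral_rpow_mul_exp_neg_rpow (p := 2) (q := 2 * a) (by norm_num)
      (by have : (0 : ℝ) ≤ a := a.cast_nonneg
          linarith)
    have h2 : ((2 * a + 2) / 2 : ℝ) = (a : ℝ) + 1 := by ring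
    rw [h2, Real.Gamma_nat_eq_factorial] at h1
    have h3 : ∀ x : ℂ, x ^ a * star x ^ a * (Real.exp (-‖x‖ ^ 2) : ℂ) =
        ((‖x‖ ^ (2 * a : ℝ) * Real.exp (-‖x‖ ^ (2 : ℝ)) : ℝ) : ℂ) := by
      intro x
      have h4 : ‖x‖ ^ (2 * a : ℝ) = (‖x‖ ^ 2) ^ a := by
        rw [← pow_mul, ← Real.rpow_natCast]
        push_cast
        rfl
      rw [← mul_pow, h4, Real.rpow_two]
      push_cast
      rw [← Complex.mul_conj']
      rfl
    simp_rw [h3]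
    rw [integral_complex_ofReal, h1]
    push_cast
    ring
  -- Rotation by the angle `π/(a-b)` preserves the Gaussian and multiplies the monomial by `-1`, so
  -- the integral equals its own negative.
  · obtain ⟨u, hu⟩ : ∃ u : Circle, (u : ℂ) ^ a * star (u : ℂ) ^ b = -1 := by
      have hab : (a : ℝ) - b ≠ 0 := sub_ne_zero.2 (by exact_mod_cast h)
      refine ⟨Circle.exp (Real.pi / (a - b)), ?_⟩
      have hs : star (Circle.exp (Real.pi / (a - b)) : ℂ) =
          Complex.exp (-(Real.pi / (a - b)) * Complex.I) := by
        rw [Circle.coe_exp, Complex.star_def, ← Complex.exp_conj]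
        simp
      rw [hs, Circle.coe_exp, ← Complex.exp_nat_mul, ← Complex.exp_nat_mul, ← Complex.exp_add,
        ← Complex.exp_pi_mul_I]
      congr 1
      have hab' : (a : ℂ) - b ≠ 0 := by exact_mod_cast hab
      push_cast
      field_simp
      ring
    have key := (rotation u).measurePreserving.integral_comp
      (rotation u).toHomeomorph.measurableEmbedding
      (fun x : ℂ => x ^ a * star x ^ b * (Real.exp (-‖x‖ ^ 2) : ℂ))
    have h5 : ∀ x : ℂ, (rotation u x) ^ a * star (rotation u x) ^ b *
        (Real.exp (-‖rotation u x‖ ^ 2) : ℂ) =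
        - (x ^ a * star x ^ b * (Real.exp (-‖x‖ ^ 2) : ℂ)) := by
      intro x
      rw [LinearIsometryEquiv.norm_map, rotation_apply, star_mul', mul_pow, mul_pow]
      linear_combination (x ^ a * star x ^ b * (Real.exp (-‖x‖ ^ 2) : ℂ)) * hu
    simp_rw [h5] at key
    rw [integral_neg] at key
    linear_combination (-1 / 2 : ℂ) * key

/-- The complex coordinates on `ℝ⁴`. -/
noncomputable def complexCoords : EuclideanSpace ℝ (Fin 4) ≃ᵐ ℂ × ℂ :=
  (MeasurableEquiv.toLp 2 (Fin 4 → ℝ)).symm.trans <|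
    (MeasurableEquiv.piCongrLeft (fun _ => ℝ) (finSumFinEquiv (m := 2) (n := 2)).symm).trans <|
    (MeasurableEquiv.sumPiEquivProdPi (fun _ => ℝ)).trans <|
    Complex.measurableEquivPi.symm.prodCongr Complex.measurableEquivPi.symm

theorem complexCoords_apply (x : EuclideanSpace ℝ (Fin 4)) :
    complexCoords x = (⟨x 0, x 1⟩, ⟨x 2, x 3⟩) := by
  have h := MeasurableEquiv.piCongrLeft_apply_apply (β := fun _ => ℝ)
    (finSumFinEquiv (m := 2) (n := 2)).symm x.ofLp
  have h' : ∀ p : Fin 2 → ℝ, Complex.measurableEquivPi.symm p = ⟨p 0, p 1⟩ := fun p => by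
    rw [Complex.measurableEquivPi_symm_apply, Complex.mk_eq_add_mul_I]
  refine Prod.ext ((h' _).trans (Complex.ext ?_ ?_)) ((h' _).trans (Complex.ext ?_ ?_))
  exacts [h 0, h 1, h 2, h 3]

theorem measurePreserving_complexCoords :
    MeasurePreserving complexCoords volume volume := by
  refine MeasurePreserving.trans (PiLp.volume_preserving_ofLp (Fin 4)) ?_
  refine MeasurePreserving.trans (volume_measurePreserving_piCongrLeft (fun _ => ℝ) _) ?_
  refine MeasurePreserving.trans (volume_measurePreserving_sumPiEquivProdPi (fun _ => ℝ)) ?_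
  exact Complex.volume_preserving_equiv_pi.symm.prod Complex.volume_preserving_equiv_pi.symm

theorem norm_sq_complexCoords (x : EuclideanSpace ℝ (Fin 4)) :
    ‖x‖ ^ 2 = ‖(complexCoords x).1‖ ^ 2 + ‖(complexCoords x).2‖ ^ 2 := by
  rw [EuclideanSpace.norm_sq_eq, complexCoords_apply, ← Complex.normSq_eq_norm_sq,
    ← Complex.normSq_eq_norm_sq, Complex.normSq_mk, Complex.normSq_mk]
  simp [Fin.sum_univ_four]
  ring

theorem mixedMonomial_smul (a b c d : ℕ) (r : ℝ) (x y : ℂ) :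
    mixedMonomial a b c d (r * x) (r * y) = r ^ (a + b + c + d) * mixedMonomial a b c d x y := by
  simp only [mixedMonomial, star_mul', Complex.star_def, Complex.conj_ofReal]
  ring

theorem integral_mixedMonomial_mul_exp (a b c d : ℕ) :
    ∫ x : EuclideanSpace ℝ (Fin 4), mixedMonomial a b c d (complexCoords x).1 (complexCoords x).2 *
      (Real.exp (-‖x‖ ^ 2) : ℂ) =
      if a = b ∧ c = d then (Real.pi ^ 2 * (a.factorial * c.factorial) : ℂ) else 0 := by
  have h : ∀ x : EuclideanSpace ℝ (Fin 4),
      mixedMonomial a b c d (complexCoords x).1 (complexCoords x).2 * (Real.exp (-‖x‖ ^ 2) : ℂ) =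
      (fun p : ℂ × ℂ => (p.1 ^ a * star p.1 ^ b * (Real.exp (-‖p.1‖ ^ 2) : ℂ)) *
        (p.2 ^ c * star p.2 ^ d * (Real.exp (-‖p.2‖ ^ 2) : ℂ))) (complexCoords x) := by
    intro x
    rw [norm_sq_complexCoords, neg_add, Real.exp_add, mixedMonomial]
    push_cast
    ring
  rw [integral_congr_ae (.of_forall h),
    measurePreserving_complexCoords.integral_comp complexCoords.measurableEmbedding
      (fun p : ℂ × ℂ => (p.1 ^ a * star p.1 ^ b * (Real.exp (-‖p.1‖ ^ 2) : ℂ)) *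
        (p.2 ^ c * star p.2 ^ d * (Real.exp (-‖p.2‖ ^ 2) : ℂ))),
    Measure.volume_eq_prod,
    integral_prod_mul (fun x : ℂ => x ^ a * star x ^ b * (Real.exp (-‖x‖ ^ 2) : ℂ))
      (fun x : ℂ => x ^ c * star x ^ d * (Real.exp (-‖x‖ ^ 2) : ℂ)),
    integral_pow_mul_star_pow_mul_exp, integral_pow_mul_star_pow_mul_exp]
  by_cases h1 : a = b <;> by_cases h2 : c = d <;> simp [h1, h2]
  ring

theorem integral_volumeIoiPow_pow_mul_exp (D : ℕ) :
    ∫ r : Set.Ioi (0 : ℝ), ((r.1 ^ D * Real.exp (-r.1 ^ 2) : ℝ) : ℂ) ∂Measure.volumeIoiPow 3 =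
      (Real.Gamma ((D + 4) / 2) / 2 : ℝ) := by
  rw [integral_complex_ofReal]
  congr 1
  simp only [Measure.volumeIoiPow, ENNReal.ofReal]
  rw [integral_withDensity_eq_integral_smul
      (measurable_subtype_coe.pow_const _).real_toNNReal,
    integral_subtype_comap measurableSet_Ioi
      fun a : ℝ ↦ Real.toNNReal (a ^ 3) • (a ^ D * Real.exp (-a ^ 2))]
  have h := integral_rpow_mul_exp_neg_rpow (p := 2) (q := D + 3) (by norm_num)
    (by have : (0 : ℝ) ≤ D := D.cast_nonneg
        linarith)
  rw [show ((D : ℝ) + 3 + 1) / 2 = (D + 4) / 2 by ring] at h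
  rw [div_eq_inv_mul, ← one_div, ← h]
  refine setIntegral_congr_fun measurableSet_Ioi fun x hx ↦ ?_
  have hx' : (0 : ℝ) ≤ x := le_of_lt hx
  simp only [NNReal.smul_def, Real.coe_toNNReal _ (pow_nonneg hx' 3), smul_eq_mul]
  rw [show ((D : ℝ) + 3) = ((D + 3 : ℕ) : ℝ) by push_cast; rfl, Real.rpow_natCast, Real.rpow_two,
    pow_add]
  ring

theorem S3.complexCoords_coe (q : S3) : complexCoords q.1 = (S3.z q, S3.w q) :=
  complexCoords_apply _

/-- Polar coordinates: by homogeneity the Gaussian integral over `ℝ⁴` is the sphere integral times a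
radial Gamma factor. -/
theorem integral_toSphere_mixedMonomial_mul (a b c d : ℕ) :
    (∫ q : S3, mixedMonomial a b c d (S3.z q) (S3.w q)
      ∂(volume : Measure (EuclideanSpace ℝ (Fin 4))).toSphere) *
      (Real.Gamma (((a + b + c + d : ℕ) + 4) / 2) / 2 : ℝ) =
      if a = b ∧ c = d then (Real.pi ^ 2 * (a.factorial * c.factorial) : ℂ) else 0 := by
  set μ : Measure (EuclideanSpace ℝ (Fin 4)) := volume
  rw [← integral_mixedMonomial_mul_exp, ← integral_volumeIoiPow_pow_mul_exp, ← integral_prod_mul]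
  have hdim : Module.finrank ℝ (EuclideanSpace ℝ (Fin 4)) - 1 = 3 := by simp
  have hmp := μ.measurePreserving_homeomorphUnitSphereProd
  rw [hdim] at hmp
  rw [← hmp.integral_comp (Homeomorph.measurableEmbedding _)]
  rw [← restrict_compl_singleton (μ := volume) (0 : EuclideanSpace ℝ (Fin 4)),
    ← integral_subtype_comap (measurableSet_singleton _).compl]
  refine integral_congr_ae (.of_forall fun x => ?_)
  have hx : ‖x.1‖ ≠ 0 := norm_ne_zero_iff.2 x.2
  have hz : complexCoords x.1 =
      ((‖x.1‖ : ℂ) * S3.z (homeomorphUnitSphereProd _ x).1,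
        (‖x.1‖ : ℂ) * S3.w (homeomorphUnitSphereProd _ x).1) := by
    rw [complexCoords_apply]
    have hmk : ∀ i j, (⟨x.1 i, x.1 j⟩ : ℂ) =
        (‖x.1‖ : ℂ) * ⟨‖x.1‖⁻¹ * x.1 i, ‖x.1‖⁻¹ * x.1 j⟩ := fun i j => by
      apply Complex.ext <;> simp [mul_inv_cancel_left₀ hx]
    simpa [S3.z, S3.w] using ⟨hmk 0 1, hmk 2 3⟩
  simp only [hz, homeomorphUnitSphereProd_apply_snd_coe, mixedMonomial_smul]
  push_cast
  ring

theorem S3.integral_mixedMonomial (a b c d : ℕ) :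
    ∫ q, mixedMonomial a b c d (S3.z q) (S3.w q) ∂S3.vol =
      if a = b ∧ c = d then (a.factorial * c.factorial / (a + c + 1).factorial : ℂ) else 0 := by
  -- The constant monomial yields the total mass `2π²`, which normalizes all the others.
  have h0 := integral_toSphere_mixedMonomial_mul 0 0 0 0
  have h1 := integral_toSphere_mixedMonomial_mul a b c d
  rw [S3.vol, integral_smul_measure]
  set T := (volume : Measure (EuclideanSpace ℝ (Fin 4))).toSphere
  simp [mixedMonomial] at h0
  rw [show ((4 : ℝ) / 2) = (1 : ℕ) + 1 by norm_num, Real.Gamma_nat_eq_factorial] at h0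
  have hT : (T.real Set.univ : ℂ) = 2 * Real.pi ^ 2 := by
    simp at h0
    linear_combination 2 * h0
  have hT' : (T Set.univ)⁻¹.toReal = (T.real Set.univ)⁻¹ := by
    rw [ENNReal.toReal_inv]
    rfl
  rw [hT', Complex.real_smul, Complex.ofReal_inv, hT]
  have hpi : (Real.pi : ℂ) ≠ 0 := by exact_mod_cast Real.pi_ne_zero
  split_ifs at h1 ⊢ with h
  · obtain ⟨rfl, rfl⟩ := h
    rw [show (((a + a + c + c : ℕ) : ℝ) + 4) / 2 = ((a + c + 1 : ℕ) : ℝ) + 1 by push_cast; ring,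
      Real.Gamma_nat_eq_factorial] at h1
    have hf : ((a + c + 1).factorial : ℂ) ≠ 0 := by exact_mod_cast Nat.factorial_ne_zero _
    push_cast at h1
    field_simp
    linear_combination 2 * h1
  · have hG : Real.Gamma (((a + b + c + d : ℕ) + 4) / 2) / 2 ≠ 0 :=
      (div_pos (Real.Gamma_pos_of_pos (by positivity)) two_pos).ne'
    rcases mul_eq_zero.1 h1 with h2 | h2
    · rw [h2, mul_zero]
    · exact absurd (Complex.ofReal_eq_zero.1 h2) hG

/-! ### The Rudin–Shapiro sequence -/

/-- The infinite Rudin-Shapiro sequence: `a 0 = 1`, `a (2n) = a n`, `a (2n+1) = (-1)^n a n`. -/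
def rudinShapiro (n : ℕ) : ℤ :=
  if n = 0 then 1
  else if n % 2 = 0 then rudinShapiro (n / 2) else (-1) ^ (n / 2) * rudinShapiro (n / 2)
termination_by n
decreasing_by all_goals omega

theorem rudinShapiro_zero : rudinShapiro 0 = 1 := by
  rw [rudinShapiro]
  simp

theorem rudinShapiro_two_mul (n : ℕ) : rudinShapiro (2 * n) = rudinShapiro n := by
  rcases Nat.eq_zero_or_pos n with rfl | h
  · rfl
  · rw [rudinShapiro, if_neg (by omega), if_pos (by omega), Nat.mul_div_cancel_left _ two_pos]

theorem rudinShapiro_two_mul_add_one (n : ℕ) :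
    rudinShapiro (2 * n + 1) = (-1) ^ n * rudinShapiro n := by
  rw [rudinShapiro, if_neg (by omega), if_neg (by omega), show (2 * n + 1) / 2 = n by omega]

theorem rudinShapiro_sq (n : ℕ) : rudinShapiro n ^ 2 = 1 := by
  induction n using Nat.strong_induction_on with
  | _ n ih =>
    rcases Nat.even_or_odd' n with ⟨k, rfl | rfl⟩
    · rcases Nat.eq_zero_or_pos k with rfl | h
      · rw [mul_zero, rudinShapiro_zero, one_pow]
      · rw [rudinShapiro_two_mul, ih k (by omega)]
    · rw [rudinShapiro_two_mul_add_one, mul_pow, ih k (by omega), ← pow_mul, mul_comm, pow_mul]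
      simp [neg_one_pow_eq_or]

theorem abs_rudinShapiro (n : ℕ) : |rudinShapiro n| = 1 := by
  have h := rudinShapiro_sq n
  rw [← sq_abs] at h
  exact (pow_eq_one_iff_of_nonneg (abs_nonneg _) two_ne_zero).1 h

/-- The sign is `-1` to the number of adjacent pairs `11` in binary. A new leading digit at position
`m+1` creates such a pair exactly when digit `m` of `j` is `1`. -/
theorem rudinShapiro_two_pow_add (m j : ℕ) (hj : j < 2 ^ (m + 1)) :
    rudinShapiro (2 ^ (m + 1) + j) = (if j < 2 ^ m then 1 else -1) * rudinShapiro j := by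
  induction m generalizing j with
  | zero =>
    have h1 : rudinShapiro 1 = 1 := by
      simpa [rudinShapiro_zero] using rudinShapiro_two_mul_add_one 0
    have h2 : rudinShapiro 2 = 1 := by simpa [h1] using rudinShapiro_two_mul 1
    have h3 : rudinShapiro 3 = -1 := by simpa [h1] using rudinShapiro_two_mul_add_one 1
    have hj' : j < 2 := by simpa using hj
    interval_cases j
    · simp [h2, rudinShapiro_zero]
    · simp [h3, h1]
  | succ m ih =>
    have hp : 2 ^ (m + 1 + 1) = 2 * 2 ^ (m + 1) := by ring
    have hp' : 2 ^ (m + 1) = 2 * 2 ^ m := by ring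
    rcases Nat.even_or_odd' j with ⟨k, rfl | rfl⟩
    · rw [hp, ← mul_add, rudinShapiro_two_mul, rudinShapiro_two_mul, ih k (by omega)]
      congr 1
      exact if_congr (by omega) rfl rfl
    · rw [hp, ← add_assoc, ← mul_add, rudinShapiro_two_mul_add_one, rudinShapiro_two_mul_add_one,
        ih k (by omega), pow_add (-1 : ℤ), hp', pow_mul (-1 : ℤ)]
      have hk : k < 2 ^ m ↔ 2 * k + 1 < 2 * 2 ^ m := by omega
      simp only [← hk]
      split_ifs <;> simp

/-- `P_m` and `Q_m` carry the two halves of the first `2^(m+1)` terms; the recursion is the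
leading-digit rule above. -/
theorem coeff_rudinShapiroPair (m j : ℕ) :
    (rudinShapiroPair m).1.coeff j = (if j < 2 ^ m then rudinShapiro j else 0) ∧
      (rudinShapiroPair m).2.coeff j = (if j < 2 ^ m then rudinShapiro (2 ^ m + j) else 0) := by
  induction m generalizing j with
  | zero =>
    have h1 : rudinShapiro 1 = 1 := by
      simpa [rudinShapiro_zero] using rudinShapiro_two_mul_add_one 0
    rcases Nat.eq_zero_or_pos j with rfl | h
    · simp [rudinShapiroPair, rudinShapiro_zero, h1]
    · simp [rudinShapiroPair, Polynomial.coeff_one, h.ne']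
  | succ m ih =>
    have hp : 2 ^ (m + 1) = 2 ^ m + 2 ^ m := by ring
    simp only [rudinShapiroPair, Polynomial.coeff_add, Polynomial.coeff_sub,
      Polynomial.coeff_X_pow_mul', (ih _).1, (ih _).2]
    by_cases h1 : j < 2 ^ m
    · have h2 : ¬ 2 ^ m ≤ j := by omega
      have h3 : j < 2 ^ (m + 1) := by omega
      simp [h1, h2, h3, rudinShapiro_two_pow_add m j h3]
    · have h2 : 2 ^ m ≤ j := by omega
      by_cases h3 : j < 2 ^ (m + 1)
      · have h4 : j - 2 ^ m < 2 ^ m := by omega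
        simp [h1, h2, h3, h4, rudinShapiro_two_pow_add m j h3]
      · have h4 : ¬ j - 2 ^ m < 2 ^ m := by omega
        simp [h1, h2, h3, h4]

/-- A Rudin-Shapiro sequence of length `N + 1` is a window of the infinite one. -/
theorem IsRudinShapiro.exists_eq_shift {N : ℕ} {σ : ℕ → ℤ} (h : IsRudinShapiro N σ) :
    ∃ t ≤ 2 * N, ∀ j ≤ N, σ j = rudinShapiro (t + j) := by
  obtain ⟨m, hm, h | h⟩ := h
  · refine ⟨0, by omega, fun j hj => ?_⟩
    rw [h j hj, (coeff_rudinShapiroPair m j).1, if_pos (by omega), zero_add]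
  · have h' : ∀ j ≤ N, σ j = rudinShapiro (2 ^ m + j) := fun j hj => by
      rw [h j hj, (coeff_rudinShapiroPair m j).2, if_pos (by omega)]
    by_cases hN : 2 ^ m ≤ 2 * N
    -- If instead `2^m > 2N`, only the first half of the coefficients of `Q_m` is seen, and there
    -- `Q_m` agrees with `P_m`, so the window may start at `0`. This keeps the offset linear in `N`.
    · exact ⟨2 ^ m, hN, h'⟩
    · refine ⟨0, by omega, fun j hj => ?_⟩
      rw [h' j hj, zero_add]
      cases m with
      | zero =>
        obtain rfl : j = 0 := by
          have : N = 0 := by simpa using hm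
          omega
        simpa using rudinShapiro_two_mul_add_one 0
      | succ m =>
        have hp : 2 ^ (m + 1) = 2 * 2 ^ m := by ring
        rw [rudinShapiro_two_pow_add m j (by omega), if_pos (by omega), one_mul]

/-! ### Logarithmic bounds for autocorrelations -/

/-- A sequence of integers of at most logarithmic growth. -/
def LogBounded (X : ℕ → ℤ) : Prop :=
  ∃ C : ℕ, ∀ n, |X n| ≤ C * (Nat.log 2 n + 1)

theorem LogBounded.of_two_mul {X Y Z : ℕ → ℤ} (hX : ∀ n, |X (n + 1) - X n| ≤ 1)
    (hY : LogBounded Y) (hZ : LogBounded Z) (h : ∀ n, |X (2 * n)| ≤ 2 * |Y n| + |Z n|) :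
    LogBounded X := by
  obtain ⟨A, hA⟩ := hY
  obtain ⟨B, hB⟩ := hZ
  have hlog : ∀ n, |X (2 * n)| ≤ (2 * A + B) * (Nat.log 2 (2 * n) + 1) := fun n => by
    have h1 : (Nat.log 2 n : ℤ) ≤ Nat.log 2 (2 * n) := by
      exact_mod_cast Nat.log_mono_right (by omega)
    nlinarith [h n, hA n, hB n, Int.natCast_nonneg A, Int.natCast_nonneg B]
  refine ⟨2 * A + B + 1, fun n => ?_⟩
  have h0 : (0 : ℤ) ≤ Nat.log 2 n := Int.natCast_nonneg _
  push_cast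
  rcases Nat.even_or_odd' n with ⟨k, rfl | rfl⟩
  · nlinarith [hlog k]
  · have h1 : (Nat.log 2 (2 * k) : ℤ) ≤ Nat.log 2 (2 * k + 1) := by
      exact_mod_cast Nat.log_mono_right (by omega)
    have h2 := abs_sub_abs_le_abs_sub (X (2 * k + 1)) (X (2 * k))
    nlinarith [hlog k, hX (2 * k), Int.natCast_nonneg A, Int.natCast_nonneg B]

/-- Halving the argument costs at most `A`, plus `1` for an odd argument, and there are `Nat.log 2
n` halvings. The coefficient one in front of `|X n|` is essential. -/
theorem LogBounded.of_two_mul_self {X : ℕ → ℤ} (hX0 : X 0 = 0) (hX : ∀ n, |X (n + 1) - X n| ≤ 1)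
    (A : ℕ) (h : ∀ n, |X (2 * n)| ≤ |X n| + A) : LogBounded X := by
  refine ⟨A + 1, fun n => ?_⟩
  push_cast
  induction n using Nat.strong_induction_on with
  | _ n ih =>
    rcases Nat.lt_or_ge n 2 with hn | hn
    · interval_cases n
      · simp [hX0]
        positivity
      · have := hX 0
        rw [hX0, sub_zero] at this
        simp only [zero_add] at this
        simp
        linarith [Int.natCast_nonneg A]
    · have hl : (Nat.log 2 n : ℤ) = Nat.log 2 (n / 2) + 1 := by
        rw [Nat.log_of_one_lt_of_le one_lt_two hn]
        push_cast
        rfl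
      rw [hl]
      rcases Nat.even_or_odd' n with ⟨k, rfl | rfl⟩
      · have h1 := ih k (by omega)
        rw [show 2 * k / 2 = k by omega]
        nlinarith [h k]
      · have h1 := ih k (by omega)
        rw [show (2 * k + 1) / 2 = k by omega]
        have h2 := abs_sub_abs_le_abs_sub (X (2 * k + 1)) (X (2 * k))
        nlinarith [h k, hX (2 * k)]

/-- The autocorrelation sums of the Rudin-Shapiro sequence. -/
def rsCorr (r n : ℕ) : ℤ :=
  ∑ j ∈ Finset.range n, rudinShapiro j * rudinShapiro (j + r)

/-- The alternating autocorrelation sums of the Rudin-Shapiro sequence. -/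
def rsAltCorr (r n : ℕ) : ℤ :=
  ∑ j ∈ Finset.range n, (-1) ^ j * (rudinShapiro j * rudinShapiro (j + r))

theorem abs_rsCorr_succ_sub (r n : ℕ) : |rsCorr r (n + 1) - rsCorr r n| ≤ 1 := by
  simp [rsCorr, Finset.sum_range_succ, abs_mul, abs_rudinShapiro]

theorem abs_rsAltCorr_succ_sub (r n : ℕ) : |rsAltCorr r (n + 1) - rsAltCorr r n| ≤ 1 := by
  simp [rsAltCorr, Finset.sum_range_succ, abs_mul, abs_rudinShapiro]

theorem Finset.sum_range_two_mul {M : Type*} [AddCommMonoid M] (f : ℕ → M) (n : ℕ) :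
    ∑ j ∈ Finset.range (2 * n), f j = ∑ i ∈ Finset.range n, (f (2 * i) + f (2 * i + 1)) := by
  induction n with
  | zero => simp
  | succ n ih =>
    rw [show 2 * (n + 1) = 2 * n + 1 + 1 by ring, Finset.sum_range_succ, Finset.sum_range_succ, ih,
      Finset.sum_range_succ, add_assoc]

theorem neg_one_pow_mul_self (i : ℕ) : ((-1 : ℤ) ^ i) * (-1) ^ i = 1 := by
  rw [← mul_pow]
  simp

/-- For an even shift both indices have the same parity and the signs `(-1)^i` cancel. For an odd
shift exactly one index is odd, so `(-1)^i` survives; hence the alternating sums are needed to close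
the recursion. -/
theorem rudinShapiro_mul_shift_even (i s : ℕ) :
    rudinShapiro (2 * i) * rudinShapiro (2 * i + 2 * s) =
        rudinShapiro i * rudinShapiro (i + s) ∧
      rudinShapiro (2 * i + 1) * rudinShapiro (2 * i + 1 + 2 * s) =
        (-1) ^ s * (rudinShapiro i * rudinShapiro (i + s)) := by
  rw [show 2 * i + 2 * s = 2 * (i + s) by ring, show 2 * i + 1 + 2 * s = 2 * (i + s) + 1 by ring]
  simp only [rudinShapiro_two_mul, rudinShapiro_two_mul_add_one, pow_add, true_and]
  linear_combination (-1) ^ s * (rudinShapiro i * rudinShapiro (i + s)) * neg_one_pow_mul_self i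

theorem rudinShapiro_mul_shift_odd (i s : ℕ) :
    rudinShapiro (2 * i) * rudinShapiro (2 * i + (2 * s + 1)) =
        (-1) ^ s * ((-1) ^ i * (rudinShapiro i * rudinShapiro (i + s))) ∧
      rudinShapiro (2 * i + 1) * rudinShapiro (2 * i + 1 + (2 * s + 1)) =
        (-1) ^ i * (rudinShapiro i * rudinShapiro (i + (s + 1))) := by
  rw [show 2 * i + (2 * s + 1) = 2 * (i + s) + 1 by ring,
    show 2 * i + 1 + (2 * s + 1) = 2 * (i + (s + 1)) by ring]
  simp only [rudinShapiro_two_mul, rudinShapiro_two_mul_add_one, pow_add]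
  constructor <;> ring

theorem rsCorr_even (s n : ℕ) : rsCorr (2 * s) (2 * n) = (1 + (-1) ^ s) * rsCorr s n := by
  simp only [rsCorr, Finset.sum_range_two_mul, Finset.mul_sum]
  refine Finset.sum_congr rfl fun i _ => ?_
  rw [(rudinShapiro_mul_shift_even i s).1, (rudinShapiro_mul_shift_even i s).2]
  ring

theorem rsAltCorr_even (s n : ℕ) : rsAltCorr (2 * s) (2 * n) = (1 - (-1) ^ s) * rsCorr s n := by
  simp only [rsCorr, rsAltCorr, Finset.sum_range_two_mul, Finset.mul_sum]
  refine Finset.sum_congr rfl fun i _ => ?_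
  rw [(rudinShapiro_mul_shift_even i s).1, (rudinShapiro_mul_shift_even i s).2, pow_succ, pow_mul]
  norm_num
  ring

theorem rsCorr_odd (s n : ℕ) :
    rsCorr (2 * s + 1) (2 * n) = (-1) ^ s * rsAltCorr s n + rsAltCorr (s + 1) n := by
  simp only [rsCorr, rsAltCorr, Finset.sum_range_two_mul, Finset.mul_sum,
    ← Finset.sum_add_distrib]
  refine Finset.sum_congr rfl fun i _ => ?_
  rw [(rudinShapiro_mul_shift_odd i s).1, (rudinShapiro_mul_shift_odd i s).2]

theorem rsAltCorr_odd (s n : ℕ) :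
    rsAltCorr (2 * s + 1) (2 * n) = (-1) ^ s * rsAltCorr s n - rsAltCorr (s + 1) n := by
  simp only [rsAltCorr, Finset.sum_range_two_mul, Finset.mul_sum, ← Finset.sum_sub_distrib]
  refine Finset.sum_congr rfl fun i _ => ?_
  rw [(rudinShapiro_mul_shift_odd i s).1, (rudinShapiro_mul_shift_odd i s).2, pow_succ, pow_mul]
  norm_num
  ring

theorem abs_one_add_neg_one_pow_mul_le (s : ℕ) (x : ℤ) : |(1 + (-1) ^ s) * x| ≤ 2 * |x| := by
  rcases neg_one_pow_eq_or ℤ s with h | h <;> simp [h, abs_mul]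

theorem abs_one_sub_neg_one_pow_mul_le (s : ℕ) (x : ℤ) : |(1 - (-1) ^ s) * x| ≤ 2 * |x| := by
  rcases neg_one_pow_eq_or ℤ s with h | h <;> simp [h, abs_mul]

/-- All summands are `±1` with alternating signs, so consecutive pairs cancel. -/
theorem abs_rsAltCorr_zero (n : ℕ) : |rsAltCorr 0 n| ≤ 1 := by
  have h0 : ∀ k, rsAltCorr 0 (2 * k) = 0 := fun k => by simpa using rsAltCorr_even 0 k
  rcases Nat.even_or_odd' n with ⟨k, rfl | rfl⟩
  · simp [h0]
  · simpa [h0] using abs_rsAltCorr_succ_sub 0 (2 * k)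

theorem logBounded_rsAltCorr_zero : LogBounded (rsAltCorr 0) :=
  ⟨1, fun n => (abs_rsAltCorr_zero n).trans (by
    push_cast
    linarith [Int.natCast_nonneg (Nat.log 2 n)])⟩

/-- Shift `1` is the one nonzero shift whose recursion refers back to itself, `A_1(2n) = A_0(n) -
A_1(n)`, so it is settled separately. -/
theorem logBounded_rsAltCorr_one : LogBounded (rsAltCorr 1) := by
  refine .of_two_mul_self (by simp [rsAltCorr]) (abs_rsAltCorr_succ_sub 1) 1 fun n => ?_
  have h := rsAltCorr_odd 0 n
  simp only [mul_zero, zero_add, pow_zero, one_mul] at h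
  rw [h]
  have := abs_sub (rsAltCorr 0 n) (rsAltCorr 1 n)
  have := abs_rsAltCorr_zero n
  push_cast
  linarith

/-- Strong induction on the shift: `2s` reduces to `s`, and `2s+1` to `s` and `s+1`, both smaller
once `s ≥ 1`. The plain sum at shift `0` equals `n` and is excluded; it never enters, since odd
shifts use alternating sums only. -/
theorem logBounded_rsCorr_rsAltCorr (r : ℕ) :
    (1 ≤ r → LogBounded (rsCorr r)) ∧ LogBounded (rsAltCorr r) := by
  induction r using Nat.strong_induction_on with
  | _ r ih =>
    have hodd : ∀ s, LogBounded (rsAltCorr s) → LogBounded (rsAltCorr (s + 1)) →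
        LogBounded (rsCorr (2 * s + 1)) ∧ LogBounded (rsAltCorr (2 * s + 1)) := fun s h1 h2 => by
      constructor
      · refine .of_two_mul (abs_rsCorr_succ_sub _) h1 h2 fun n => ?_
        rw [rsCorr_odd]
        refine (abs_add_le _ _).trans ?_
        rw [abs_mul, abs_pow, abs_neg, abs_one, one_pow, one_mul]
        linarith [abs_nonneg (rsAltCorr s n)]
      · refine .of_two_mul (abs_rsAltCorr_succ_sub _) h1 h2 fun n => ?_
        rw [rsAltCorr_odd]
        refine (abs_sub _ _).trans ?_
        rw [abs_mul, abs_pow, abs_neg, abs_one, one_pow, one_mul]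
        linarith [abs_nonneg (rsAltCorr s n)]
    rcases Nat.even_or_odd' r with ⟨s, rfl | rfl⟩
    · rcases Nat.eq_zero_or_pos s with rfl | hs
      · exact ⟨fun h => absurd h (by omega), logBounded_rsAltCorr_zero⟩
      · have h1 := (ih s (by omega)).1 hs
        refine ⟨fun _ => .of_two_mul (abs_rsCorr_succ_sub _) h1 h1 fun n => ?_,
          .of_two_mul (abs_rsAltCorr_succ_sub _) h1 h1 fun n => ?_⟩
        · rw [rsCorr_even]
          linarith [abs_one_add_neg_one_pow_mul_le s (rsCorr s n), abs_nonneg (rsCorr s n)]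
        · rw [rsAltCorr_even]
          linarith [abs_one_sub_neg_one_pow_mul_le s (rsCorr s n), abs_nonneg (rsCorr s n)]
    · rcases Nat.eq_zero_or_pos s with rfl | hs
      · have := hodd 0 logBounded_rsAltCorr_zero logBounded_rsAltCorr_one
        exact ⟨fun _ => this.1, this.2⟩
      · have := hodd s (ih s (by omega)).2 (ih (s + 1) (by omega)).2
        exact ⟨fun _ => this.1, this.2⟩

/-- Uniform bound for the autocorrelations of finite Rudin-Shapiro sequences. -/
theorem exists_abs_sum_mul_shift_le (r : ℕ) (hr : 1 ≤ r) :
    ∃ C : ℕ, ∀ (N : ℕ) (σ : ℕ → ℤ), IsRudinShapiro N σ → ∀ n, n + r ≤ N + 1 →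
      |∑ j ∈ Finset.range n, σ j * σ (j + r)| ≤ C * (Nat.log 2 (3 * N + 1) + 1) := by
  obtain ⟨C, hC⟩ := (logBounded_rsCorr_rsAltCorr r).1 hr
  refine ⟨2 * C, fun N σ hσ n hn => ?_⟩
  obtain ⟨t, ht, hσt⟩ := hσ.exists_eq_shift
  -- A window sum is a difference of two initial sums of the infinite sequence, with endpoints at
  -- most `3N+1`.
  have h1 : ∑ j ∈ Finset.range n, σ j * σ (j + r) = rsCorr r (t + n) - rsCorr r t := by
    rw [rsCorr, rsCorr, Finset.sum_range_add, add_sub_cancel_left]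
    refine Finset.sum_congr rfl fun j hj => ?_
    have := Finset.mem_range.1 hj
    rw [hσt j (by omega), hσt (j + r) (by omega), add_assoc]
  rw [h1]
  have h2 : ∀ k ≤ 3 * N + 1, |rsCorr r k| ≤ C * (Nat.log 2 (3 * N + 1) + 1) := fun k hk => by
    refine (hC k).trans ?_
    gcongr
  have := abs_sub (rsCorr r (t + n)) (rsCorr r t)
  have := h2 (t + n) (by omega)
  have := h2 t (by omega)
  push_cast
  linarith

theorem IsRudinShapiro.sq_eq_one {N : ℕ} {σ : ℕ → ℤ} (h : IsRudinShapiro N σ) {j : ℕ}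
    (hj : j ≤ N) : σ j ^ 2 = 1 := by
  obtain ⟨t, -, ht⟩ := h.exists_eq_shift
  rw [ht j hj, rudinShapiro_sq]

/-! ### Expansion of the squared harmonic -/

theorem S3.continuous_z : Continuous S3.z := by
  have h : S3.z = fun q : S3 => ((q.1 0 : ℝ) : ℂ) + (q.1 1 : ℝ) * Complex.I :=
    funext fun q => Complex.mk_eq_add_mul_I _ _
  rw [h]
  fun_prop

theorem S3.continuous_w : Continuous S3.w := by
  have h : S3.w = fun q : S3 => ((q.1 2 : ℝ) : ℂ) + (q.1 3 : ℝ) * Complex.I :=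
    funext fun q => Complex.mk_eq_add_mul_I _ _
  rw [h]
  fun_prop

theorem S3.continuous_mixedMonomial (a b c d : ℕ) :
    Continuous fun q => mixedMonomial a b c d (S3.z q) (S3.w q) := by
  have := S3.continuous_z
  have := S3.continuous_w
  unfold mixedMonomial
  fun_prop

theorem S3.norm_sq_z_add_norm_sq_w (q : S3) : ‖S3.z q‖ ^ 2 + ‖S3.w q‖ ^ 2 = 1 := by
  have h := norm_sq_complexCoords q.1
  rw [S3.complexCoords_coe, norm_eq_of_mem_sphere q] at h
  simpa using h.symm

instance : IsProbabilityMeasure S3.vol := by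
  have : NeZero (volume : Measure (EuclideanSpace ℝ (Fin 4))).toSphere :=
    ⟨Measure.toSphere_ne_zero _⟩
  exact isProbabilityMeasureSMul

theorem S3.integrable_of_continuous {g : S3 → ℂ} (hg : Continuous g) : Integrable g S3.vol :=
  hg.integrable_of_hasCompactSupport (.of_compactSpace g)

/-- The `L²` norm of the monomial `z^j w^(N-j)`. -/
noncomputable def monomialNorm (N j : ℕ) : ℝ :=
  Real.sqrt (j.factorial * (N - j).factorial / (N + 1).factorial)

theorem S3.l2norm_monomial {N j : ℕ} (hj : j ≤ N) :
    S3.l2norm (fun p => S3.z p ^ j * S3.w p ^ (N - j)) = monomialNorm N j := by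
  rw [S3.l2norm, monomialNorm]
  congr 1
  have h := S3.integral_mixedMonomial j j (N - j) (N - j)
  rw [if_pos ⟨rfl, rfl⟩, Nat.add_sub_cancel' hj] at h
  have h' : ∀ q : S3, mixedMonomial j j (N - j) (N - j) (S3.z q) (S3.w q) =
      ((‖S3.z q ^ j * S3.w q ^ (N - j)‖ ^ 2 : ℝ) : ℂ) := fun q => by
    rw [Complex.ofReal_pow, ← Complex.mul_conj', mixedMonomial]
    simp only [map_mul, map_pow, Complex.star_def]
    ring
  simp_rw [h'] at h
  rw [integral_complex_ofReal] at h
  apply Complex.ofReal_injective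
  rw [h]
  push_cast
  rfl

/-- The phase `e^(2πijk/(N+1))`. -/
noncomputable def fourierPhase (N k j : ℕ) : ℂ :=
  Complex.exp (2 * Real.pi * Complex.I * j * k / (N + 1))

/-- Only the index difference `r` matters, so the phase leaves the sum over `j`. -/
theorem fourierPhase_mul_star (N k j r : ℕ) :
    fourierPhase N k j * star (fourierPhase N k (j + r)) = star (fourierPhase N k r) := by
  simp only [fourierPhase, Complex.star_def, ← Complex.exp_conj, ← Complex.exp_add]
  congr 1
  simp only [map_div₀, map_mul, map_add, map_one, Complex.conj_ofReal, Complex.conj_I,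
    map_natCast, map_ofNat]
  push_cast
  ring

theorem norm_fourierPhase (N k j : ℕ) : ‖fourierPhase N k j‖ = 1 := by
  rw [fourierPhase, show (2 * Real.pi * Complex.I * j * k / (N + 1) : ℂ) =
    ((2 * Real.pi * j * k / (N + 1) : ℝ) : ℂ) * Complex.I by push_cast; ring]
  exact Complex.norm_exp_ofReal_mul_I _

theorem ofReal_norm_sq_bourgainHarmonic (σ : ℕ → ℤ) (N k : ℕ) (q : S3) :
    ((‖bourgainHarmonic σ N k q‖ ^ 2 : ℝ) : ℂ) =
      1 / (N + 1) * ∑ j ∈ Finset.range (N + 1), ∑ l ∈ Finset.range (N + 1),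
        (σ j * σ l * (fourierPhase N k j * star (fourierPhase N k l)) /
          (monomialNorm N j * monomialNorm N l)) *
        mixedMonomial j l (N - j) (N - l) (S3.z q) (S3.w q) := by
  have h1 : bourgainHarmonic σ N k q = 1 / (Real.sqrt ((N : ℝ) + 1) : ℂ) *
      ∑ j ∈ Finset.range (N + 1), (σ j : ℂ) * fourierPhase N k j *
        ((S3.z q ^ j * S3.w q ^ (N - j)) / (monomialNorm N j : ℂ)) := by
    rw [bourgainHarmonic]
    congr 1
    refine Finset.sum_congr rfl fun j hj => ?_
    rw [S3.l2norm_monomial (Nat.lt_succ_iff.1 (Finset.mem_range.1 hj)), fourierPhase]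
  have h2 : (Real.sqrt ((N : ℝ) + 1) : ℂ) * (Real.sqrt ((N : ℝ) + 1) : ℂ) = N + 1 := by
    rw [← Complex.ofReal_mul, Real.mul_self_sqrt (by positivity)]
    push_cast
    rfl
  rw [Complex.ofReal_pow, ← Complex.mul_conj', h1, map_mul, mul_mul_mul_comm, map_div₀, map_one,
    Complex.conj_ofReal, div_mul_div_comm, h2, one_mul, map_sum, Finset.sum_mul_sum]
  congr 1
  refine Finset.sum_congr rfl fun j _ => Finset.sum_congr rfl fun l _ => ?_
  simp only [map_mul, map_div₀, map_pow, Complex.conj_ofReal, mixedMonomial, map_intCast,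
    Complex.star_def]
  ring

theorem mixedMonomial_mul (a b c d a' b' c' d' : ℕ) (x y : ℂ) :
    mixedMonomial a b c d x y * mixedMonomial a' b' c' d' x y =
      mixedMonomial (a + a') (b + b') (c + c') (d + d') x y := by
  simp only [mixedMonomial, pow_add]
  ring

theorem integral_mixedMonomial_mul_bourgainHarmonic (σ : ℕ → ℤ) (N k a b c d : ℕ) :
    ∫ q, mixedMonomial a b c d (S3.z q) (S3.w q) *
        ((‖bourgainHarmonic σ N k q‖ ^ 2 : ℝ) : ℂ) ∂S3.vol =
      1 / (N + 1) * ∑ j ∈ Finset.range (N + 1), ∑ l ∈ Finset.range (N + 1),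
        (σ j * σ l * (fourierPhase N k j * star (fourierPhase N k l)) /
          (monomialNorm N j * monomialNorm N l)) *
        (if a + j = b + l ∧ c + (N - j) = d + (N - l) then
          ((a + j).factorial * (c + (N - j)).factorial / (a + j + (c + (N - j)) + 1).factorial : ℂ)
          else 0) := by
  have h : ∀ q, mixedMonomial a b c d (S3.z q) (S3.w q) *
        ((‖bourgainHarmonic σ N k q‖ ^ 2 : ℝ) : ℂ) =
      1 / (N + 1) * ∑ j ∈ Finset.range (N + 1), ∑ l ∈ Finset.range (N + 1),
        (σ j * σ l * (fourierPhase N k j * star (fourierPhase N k l)) /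
          (monomialNorm N j * monomialNorm N l)) *
        mixedMonomial (a + j) (b + l) (c + (N - j)) (d + (N - l)) (S3.z q) (S3.w q) := fun q => by
    simp only [ofReal_norm_sq_bourgainHarmonic, ← mixedMonomial_mul, Finset.mul_sum]
    refine Finset.sum_congr rfl fun j _ => Finset.sum_congr rfl fun l _ => ?_
    ring
  have hint : ∀ (x : ℂ) (j l : ℕ), Integrable (fun q : S3 => x *
      mixedMonomial (a + j) (b + l) (c + (N - j)) (d + (N - l)) (S3.z q) (S3.w q)) S3.vol :=
    fun x j l => (S3.integrable_of_continuous (S3.continuous_mixedMonomial _ _ _ _)).const_mul x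
  simp_rw [h]
  rw [integral_const_mul, integral_finsetSum _ fun j _ => integrable_finsetSum _ fun l _ =>
    hint _ j l]
  congr 1
  refine Finset.sum_congr rfl fun j _ => ?_
  rw [integral_finsetSum _ fun l _ => hint _ j l]
  refine Finset.sum_congr rfl fun l _ => ?_
  rw [integral_const_mul, S3.integral_mixedMonomial]

theorem one_div_mul_monomialNorm (N j : ℕ) (hj : j ≤ N) :
    (1 / (N + 1) * (1 / (monomialNorm N j * monomialNorm N j)) : ℂ) = N.choose j := by
  have h : monomialNorm N j * monomialNorm N j =
      j.factorial * (N - j).factorial / (N + 1).factorial := Real.mul_self_sqrt (by positivity)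
  rw [← Complex.ofReal_mul, h, Nat.cast_choose ℂ hj, Nat.factorial_succ]
  push_cast
  have h1 : (N : ℂ) + 1 ≠ 0 := by exact_mod_cast N.succ_ne_zero
  have h2 : (N.factorial : ℂ) ≠ 0 := by exact_mod_cast N.factorial_ne_zero
  have h3 : (j.factorial : ℂ) ≠ 0 := by exact_mod_cast j.factorial_ne_zero
  have h4 : ((N - j).factorial : ℂ) ≠ 0 := by exact_mod_cast (N - j).factorial_ne_zero
  field_simp

/-- The binomial theorem for `(|z|² + |w|²)^N = 1`. -/
theorem S3.sum_choose_mul_mixedMonomial (N : ℕ) (q : S3) :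
    ∑ j ∈ Finset.range (N + 1),
      (N.choose j : ℂ) * mixedMonomial j j (N - j) (N - j) (S3.z q) (S3.w q) = 1 := by
  have h : S3.z q * star (S3.z q) + S3.w q * star (S3.w q) = 1 := by
    rw [Complex.star_def, Complex.mul_conj', Complex.mul_conj']
    exact_mod_cast S3.norm_sq_z_add_norm_sq_w q
  have h' := (add_pow (S3.z q * star (S3.z q)) (S3.w q * star (S3.w q)) N).symm
  rw [h, one_pow] at h'
  rw [← h']
  refine Finset.sum_congr rfl fun j _ => ?_
  simp only [mixedMonomial, mul_pow]
  ring

/-- Diagonal test monomials are integrated exactly. -/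
theorem integral_diagonal_mul_bourgainHarmonic {σ : ℕ → ℤ} {N : ℕ} (hσ : IsRudinShapiro N σ)
    (k a c : ℕ) :
    ∫ q, mixedMonomial a a c c (S3.z q) (S3.w q) *
        ((‖bourgainHarmonic σ N k q‖ ^ 2 : ℝ) : ℂ) ∂S3.vol =
      ∫ q, mixedMonomial a a c c (S3.z q) (S3.w q) ∂S3.vol := by
  -- Multiplying the test monomial by this expansion of `1` lets the two integrals be compared term
  -- by term in `j`.
  have h1 : ∀ q : S3, mixedMonomial a a c c (S3.z q) (S3.w q) =
      ∑ j ∈ Finset.range (N + 1), (N.choose j : ℂ) *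
        mixedMonomial (a + j) (a + j) (c + (N - j)) (c + (N - j)) (S3.z q) (S3.w q) := fun q => by
    conv_lhs => rw [← mul_one (mixedMonomial a a c c (S3.z q) (S3.w q)),
      ← S3.sum_choose_mul_mixedMonomial N q, Finset.mul_sum]
    refine Finset.sum_congr rfl fun j _ => ?_
    rw [← mixedMonomial_mul]
    ring
  rw [integral_mixedMonomial_mul_bourgainHarmonic, integral_congr_ae (.of_forall h1),
    integral_finsetSum _ fun j _ =>
      (S3.integrable_of_continuous (S3.continuous_mixedMonomial _ _ _ _)).const_mul _,
    Finset.mul_sum]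
  refine Finset.sum_congr rfl fun j hj => ?_
  have hjN := Nat.lt_succ_iff.1 (Finset.mem_range.1 hj)
  rw [Finset.sum_eq_single_of_mem j hj fun l _ hl => by
      rw [if_neg fun h => hl (by omega), mul_zero],
    integral_const_mul, S3.integral_mixedMonomial, if_pos ⟨rfl, rfl⟩,
    ← one_div_mul_monomialNorm N j hjN]
  have hs : (σ j * σ j : ℂ) = 1 := by
    have := hσ.sq_eq_one hjN
    rw [sq] at this
    exact_mod_cast this
  have hp : fourierPhase N k j * star (fourierPhase N k j) = 1 := by
    rw [Complex.star_def, Complex.mul_conj', norm_fourierPhase]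
    norm_num
  rw [hs, hp]
  ring

theorem integral_norm_sq_bourgainHarmonic {σ : ℕ → ℤ} {N : ℕ} (hσ : IsRudinShapiro N σ) (k : ℕ) :
    ∫ q, ‖bourgainHarmonic σ N k q‖ ^ 2 ∂S3.vol = 1 := by
  have h := integral_diagonal_mul_bourgainHarmonic hσ k 0 0
  simp only [mixedMonomial, pow_zero, mul_one, one_mul] at h
  rw [integral_complex_ofReal] at h
  simpa using h

/-! ### Summation by parts with monotone weights -/

theorem abs_sum_mul_le_of_antitone {x v : ℕ → ℝ} {M : ℝ} {n : ℕ} (hv : Antitone v)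
    (hv0 : ∀ j, 0 ≤ v j) (hx : ∀ m ≤ n, |∑ j ∈ Finset.range m, x j| ≤ M) :
    ∀ m ≤ n, |∑ j ∈ Finset.range m, v j * x j| ≤ v 0 * M := by
  -- The difference is the Abel sum `∑ (v_j - v_{j+1}) S_{j+1}` over the partial sums `S`, whose
  -- coefficients are nonnegative and telescope.
  have key : ∀ m ≤ n, |∑ j ∈ Finset.range m, v j * x j - v m * ∑ j ∈ Finset.range m, x j| ≤
      (v 0 - v m) * M := fun m => by
    induction m with
    | zero => simp
    | succ m ih =>
      intro hm
      have h1 := ih (by omega)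
      have h2 : ∑ j ∈ Finset.range (m + 1), v j * x j - v (m + 1) * ∑ j ∈ Finset.range (m + 1), x j =
          (∑ j ∈ Finset.range m, v j * x j - v m * ∑ j ∈ Finset.range m, x j) +
            (v m - v (m + 1)) * ∑ j ∈ Finset.range (m + 1), x j := by
        simp only [Finset.sum_range_succ]
        ring
      have h3 : 0 ≤ v m - v (m + 1) := sub_nonneg.2 (hv m.le_succ)
      rw [h2]
      refine (abs_add_le _ _).trans ?_
      rw [abs_mul, abs_of_nonneg h3]
      have := mul_le_mul_of_nonneg_left (hx (m + 1) hm) h3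
      linarith
  intro m hm
  have h1 := key m hm
  have h2 := abs_add_le (∑ j ∈ Finset.range m, v j * x j - v m * ∑ j ∈ Finset.range m, x j)
    (v m * ∑ j ∈ Finset.range m, x j)
  rw [sub_add_cancel, abs_mul, abs_of_nonneg (hv0 m)] at h2
  have := mul_le_mul_of_nonneg_left (hx m hm) (hv0 m)
  linarith

theorem abs_sum_mul_le_of_monotone {y u : ℕ → ℝ} {M : ℝ} {n : ℕ} (hu : Monotone u)
    (hu0 : ∀ j, 0 ≤ u j) (hy : ∀ m ≤ n + 1, |∑ j ∈ Finset.range m, y j| ≤ M) :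
    |∑ j ∈ Finset.range (n + 1), u j * y j| ≤ 2 * u n * M := by
  have hM : 0 ≤ M := (abs_nonneg _).trans (hy 0 (by omega))
  -- The complementary weight `u n - u j` decreases; the truncation `min j n` keeps it nonnegative
  -- and antitone on all of `ℕ`.
  have h1 := abs_sum_mul_le_of_antitone (v := fun j => u n - u (min j n))
    (fun i j hij => sub_le_sub_left (hu (min_le_min_right n hij)) _)
    (fun j => sub_nonneg.2 (hu (min_le_right j n))) hy (n + 1) le_rfl
  have h2 : ∑ j ∈ Finset.range (n + 1), u j * y j = u n * ∑ j ∈ Finset.range (n + 1), y j -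
      ∑ j ∈ Finset.range (n + 1), (u n - u (min j n)) * y j := by
    rw [Finset.mul_sum, ← Finset.sum_sub_distrib]
    refine Finset.sum_congr rfl fun j hj => ?_
    rw [min_eq_left (Nat.lt_succ_iff.1 (Finset.mem_range.1 hj))]
    ring
  have h3 := mul_le_mul_of_nonneg_left (hy (n + 1) le_rfl) (hu0 n)
  have h4 := mul_nonneg (hu0 0) hM
  rw [h2]
  refine (abs_sub _ _).trans ?_
  rw [abs_mul, abs_of_nonneg (hu0 n)]
  simp only [zero_le, inf_of_le_left] at h1
  linarith

/-- The decreasing factor is absorbed first, with control of every partial sum; these then serve as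
input for the increasing factor. -/
theorem abs_sum_mul_mul_reflect_le {x u v : ℕ → ℝ} {M : ℝ} {n : ℕ} (hu : Monotone u)
    (hu0 : ∀ j, 0 ≤ u j) (hv : Monotone v) (hv0 : ∀ j, 0 ≤ v j)
    (hx : ∀ m ≤ n + 1, |∑ j ∈ Finset.range m, x j| ≤ M) :
    |∑ j ∈ Finset.range (n + 1), u j * (v (n - j) * x j)| ≤ 2 * u n * (v n * M) :=
  abs_sum_mul_le_of_monotone hu hu0 <|
    abs_sum_mul_le_of_antitone (v := fun j => v (n - j))
      (fun _ _ hij => hv (Nat.sub_le_sub_left hij n)) (fun j => hv0 (n - j)) hx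

/-! ### Factorial weights and the off-diagonal estimate -/

/-- The weights in the off-diagonal sums. -/
noncomputable def factorialWeight (r a j : ℕ) : ℝ :=
  (a + j).factorial / (Real.sqrt j.factorial * Real.sqrt (j + r).factorial)

theorem factorialWeight_nonneg (r a j : ℕ) : 0 ≤ factorialWeight r a j := by
  unfold factorialWeight
  positivity

theorem monotone_factorialWeight {r a : ℕ} (h : r ≤ a) : Monotone (factorialWeight r a) := by
  refine monotone_nat_of_le_succ fun j => ?_
  have e : j + 1 + r = (j + r) + 1 := by ring
  simp only [factorialWeight]
  rw [e, ← add_assoc, Nat.factorial_succ (a + j), Nat.factorial_succ j, Nat.factorial_succ (j + r)]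
  push_cast
  rw [Real.sqrt_mul (by positivity), Real.sqrt_mul (by positivity)]
  -- The ratio of successive weights is `(a+j+1) / √((j+1)(j+r+1))`, which is at least one because
  -- `r ≤ a`.
  have h1 : Real.sqrt ((j : ℝ) + 1) * Real.sqrt ((j : ℝ) + r + 1) ≤ a + j + 1 := by
    rw [← Real.sqrt_mul (by positivity)]
    refine Real.sqrt_le_iff.2 ⟨by positivity, ?_⟩
    have h' : (r : ℝ) ≤ a := by exact_mod_cast h
    have h'' : (0 : ℝ) ≤ r := r.cast_nonneg
    rw [sq]
    apply mul_le_mul <;> first | positivity | linarith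
  rw [div_le_div_iff₀ (by positivity) (by positivity)]
  have h2 : 0 ≤ ((a + j).factorial : ℝ) * (Real.sqrt j.factorial * Real.sqrt (j + r).factorial) := by
    positivity
  nlinarith [mul_le_mul_of_nonneg_left h1 h2]

theorem factorial_add_le (n k : ℕ) : (n + k).factorial ≤ n.factorial * (n + k) ^ k := by
  rw [← Nat.factorial_mul_ascFactorial]
  exact Nat.mul_le_mul_left _ (Nat.ascFactorial_le_pow_add n k)

/-- The endpoint weights grow together like `n^(b+c+r)`, which is the decay rate of the factorial
quotient in front; hence a bound independent of `n`. -/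
theorem factorialWeight_mul_le (r b c n : ℕ) :
    ((n + r + 1).factorial / (b + r + c + (n + r) + 1).factorial : ℝ) *
      (factorialWeight r (b + r) n * factorialWeight r (c + r) n) ≤
      (b + 1) ^ b * (c + 1) ^ (c + r) := by
  have h1 : factorialWeight r (b + r) n * factorialWeight r (c + r) n =
      ((b + r + n).factorial * (c + r + n).factorial) / (n.factorial * (n + r).factorial) := by
    rw [factorialWeight, factorialWeight, div_mul_div_comm, mul_mul_mul_comm,
      Real.mul_self_sqrt (by positivity), Real.mul_self_sqrt (by positivity)]
  have e1 : b + r + n = (n + r) + b := by ring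
  have e2 : c + r + n = n + (c + r) := by ring
  have e3 : b + r + c + (n + r) + 1 = (n + r + 1) + (b + (c + r)) := by ring
  have h2 := factorial_add_le (n + r) b
  have h3 := factorial_add_le n (c + r)
  have h4 := Nat.factorial_mul_pow_le_factorial (m := n + r + 1) (n := b + (c + r))
  have h5 : n + r + b ≤ (b + 1) * (n + r + 1 + 1) := by nlinarith
  have h6 : n + (c + r) ≤ (c + 1) * (n + r + 1 + 1) := by nlinarith
  rw [h1, div_mul_div_comm, div_le_iff₀ (by positivity), e1, e2, e3]
  have key : (n + r + 1).factorial * ((n + r + b).factorial * (n + (c + r)).factorial) ≤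
      (b + 1) ^ b * (c + 1) ^ (c + r) *
        ((n + r + 1 + (b + (c + r))).factorial * (n.factorial * (n + r).factorial)) :=
    calc _ ≤ (n + r + 1).factorial * (((n + r).factorial * ((b + 1) * (n + r + 1 + 1)) ^ b) *
          (n.factorial * ((c + 1) * (n + r + 1 + 1)) ^ (c + r))) := by
            gcongr
            · exact h2.trans (by gcongr)
            · exact h3.trans (by gcongr)
      _ = (b + 1) ^ b * (c + 1) ^ (c + r) * (((n + r + 1).factorial *
          (n + r + 1 + 1) ^ (b + (c + r))) * (n.factorial * (n + r).factorial)) := by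
            rw [mul_pow, mul_pow, pow_add (n + r + 1 + 1)]
            ring
      _ ≤ _ := by gcongr
  exact_mod_cast key

theorem factorial_div_monomialNorm_mul (r a c i j : ℕ) :
    ((a + j).factorial * (c + (i + r)).factorial / (a + j + (c + (i + r)) + 1).factorial : ℝ) /
      (monomialNorm (j + i + r) j * monomialNorm (j + i + r) (j + r)) =
    (j + i + r + 1).factorial / (a + c + (j + i + r) + 1).factorial *
      (factorialWeight r a j * factorialWeight r (c + r) i) := by
  have e1 : j + i + r - j = i + r := by omega
  have e2 : j + i + r - (j + r) = i := by omega
  have e3 : a + j + (c + (i + r)) + 1 = a + c + (j + i + r) + 1 := by ring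
  have e4 : c + (i + r) = c + r + i := by ring
  have hs : Real.sqrt (j + i + r + 1).factorial * Real.sqrt (j + i + r + 1).factorial =
    (j + i + r + 1).factorial := Real.mul_self_sqrt (by positivity)
  rw [monomialNorm, monomialNorm, e1, e2, e3, e4, factorialWeight, factorialWeight,
    Real.sqrt_div (by positivity), Real.sqrt_div (by positivity), Real.sqrt_mul (by positivity),
    Real.sqrt_mul (by positivity)]
  have h1 : Real.sqrt (j + i + r + 1).factorial ≠ 0 := by positivity
  have h2 : Real.sqrt j.factorial ≠ 0 := by positivity
  have h3 : Real.sqrt i.factorial ≠ 0 := by positivity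
  have h4 : Real.sqrt (j + r).factorial ≠ 0 := by positivity
  have h5 : Real.sqrt (i + r).factorial ≠ 0 := by positivity
  field_simp
  linear_combination hs

theorem integral_offDiagonal_mul_bourgainHarmonic (σ : ℕ → ℤ) (k n r b c : ℕ) :
    ∫ q, mixedMonomial (b + r) b c (c + r) (S3.z q) (S3.w q) *
        ((‖bourgainHarmonic σ (n + r) k q‖ ^ 2 : ℝ) : ℂ) ∂S3.vol =
      star (fourierPhase (n + r) k r) *
        ((1 / ((n + r : ℕ) + 1) *
          ((n + r + 1).factorial / (b + r + c + (n + r) + 1).factorial *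
          ∑ j ∈ Finset.range (n + 1), factorialWeight r (b + r) j *
            (factorialWeight r (c + r) (n - j) * ((σ j * σ (j + r) : ℤ) : ℝ))) : ℝ) : ℂ) := by
  rw [integral_mixedMonomial_mul_bourgainHarmonic, show n + r + 1 = (n + 1) + r by ring,
    Finset.sum_range_add (n := n + 1) (m := r)]
  -- With `N = n + r`, the last `r` indices `j` have no partner `l = j + r ≤ N`.
  rw [Finset.sum_eq_zero (s := Finset.range r), add_zero]
  · push_cast
    rw [Finset.mul_sum, Finset.mul_sum, Finset.mul_sum, Finset.mul_sum]
    refine Finset.sum_congr rfl fun j hj => ?_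
    obtain ⟨i, rfl⟩ := Nat.exists_eq_add_of_le (Nat.lt_succ_iff.1 (Finset.mem_range.1 hj))
    have e1 : j + i + r - j = i + r := by omega
    have e2 : j + i + r - (j + r) = i := by omega
    rw [Finset.sum_eq_single_of_mem (j + r) (Finset.mem_range.2 (by omega)) fun l hl hne => by
      rw [if_neg fun h => hne (by omega), mul_zero], if_pos (by omega), fourierPhase_mul_star,
      e1, Nat.add_sub_cancel_left]
    have h := congrArg (fun x : ℝ => (x : ℂ)) (factorial_div_monomialNorm_mul r (b + r) c i j)
    push_cast at h
    rw [show j + i + 1 + r = j + i + r + 1 by ring]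
    linear_combination (1 / (((j + i : ℕ) : ℂ) + r + 1) * (σ j * σ (j + r) *
      star (fourierPhase (j + i + r) k r)) : ℂ) * h
  · intro j hj
    refine Finset.sum_eq_zero fun l hl => ?_
    have hj' := Finset.mem_range.1 hj
    have hl' := Finset.mem_range.1 hl
    rw [if_neg (by omega), mul_zero]

theorem norm_integral_offDiagonal_le {σ : ℕ → ℤ} {k n r b c : ℕ} {M : ℝ}
    (hM : ∀ m ≤ n + 1, |((∑ j ∈ Finset.range m, σ j * σ (j + r) : ℤ) : ℝ)| ≤ M) :
    ‖∫ q, mixedMonomial (b + r) b c (c + r) (S3.z q) (S3.w q) *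
        ((‖bourgainHarmonic σ (n + r) k q‖ ^ 2 : ℝ) : ℂ) ∂S3.vol‖ ≤
      2 * ((b + 1) ^ b * (c + 1) ^ (c + r)) * (M / ((n + r : ℕ) + 1)) := by
  have hM0 : 0 ≤ M := (abs_nonneg _).trans (hM 0 (by omega))
  rw [integral_offDiagonal_mul_bourgainHarmonic, norm_mul, norm_star, norm_fourierPhase, one_mul,
    Complex.norm_real, Real.norm_eq_abs, abs_mul, abs_mul, abs_of_nonneg (by positivity),
    abs_of_nonneg (by positivity)]
  have h1 := abs_sum_mul_mul_reflect_le
    (monotone_factorialWeight (r := r) (a := b + r) (by omega)) (factorialWeight_nonneg r (b + r))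
    (monotone_factorialWeight (r := r) (a := c + r) (by omega)) (factorialWeight_nonneg r (c + r))
    (x := fun j => ((σ j * σ (j + r) : ℤ) : ℝ)) (n := n) (M := M)
    (fun m hm => by simpa using hM m hm)
  have h2 := mul_le_mul_of_nonneg_right (factorialWeight_mul_le r b c n) hM0
  calc _ ≤ 1 / ((n + r : ℕ) + 1 : ℝ) *
        ((n + r + 1).factorial / (b + r + c + (n + r) + 1).factorial *
          (2 * factorialWeight r (b + r) n * (factorialWeight r (c + r) n * M))) := by gcongr
    _ = 2 * (1 / ((n + r : ℕ) + 1 : ℝ)) *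
        ((n + r + 1).factorial / (b + r + c + (n + r) + 1).factorial *
          (factorialWeight r (b + r) n * factorialWeight r (c + r) n) * M) := by ring
    _ ≤ 2 * (1 / ((n + r : ℕ) + 1 : ℝ)) * ((b + 1) ^ b * (c + 1) ^ (c + r) * M) := by gcongr
    _ = _ := by ring

theorem tendsto_natLog_div_atTop :
    Tendsto (fun N : ℕ => ((Nat.log 2 (3 * N + 1) : ℝ) + 1) / (N + 1)) atTop (𝓝 0) := by
  have hu : Tendsto (fun N : ℕ => (3 * N + 1 : ℝ)) atTop atTop :=
    tendsto_atTop_add_const_right _ _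
      (tendsto_natCast_atTop_atTop.const_mul_atTop (by norm_num : (0 : ℝ) < 3))
  have h1 := (Real.isLittleO_log_id_atTop.tendsto_div_nhds_zero).comp hu
  have h2 := tendsto_inv_atTop_zero.comp hu
  have h3 := ((h1.const_mul (3 / Real.log 2)).add (h2.const_mul 3))
  simp only [mul_zero, add_zero] at h3
  refine squeeze_zero (fun N => by positivity) (fun N => ?_) h3
  have hl : (Nat.log 2 (3 * N + 1) : ℝ) ≤ Real.log (3 * N + 1) / Real.log 2 := by
    have := Real.natLog_le_logb (3 * N + 1) 2
    push_cast at this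
    exact this
  have hlog2 : 0 < Real.log 2 := Real.log_pos one_lt_two
  have hu0 : (0 : ℝ) < 3 * N + 1 := by positivity
  have hlog : 0 ≤ Real.log (3 * N + 1) := Real.log_nonneg (by
    have : (0 : ℝ) ≤ N := N.cast_nonneg
    linarith)
  simp only [Function.comp_apply, id]
  calc _ ≤ (Real.log (3 * N + 1) / Real.log 2 + 1) / (N + 1) := by gcongr
    _ ≤ (Real.log (3 * N + 1) / Real.log 2 + 1) / ((3 * N + 1) / 3) := by
      gcongr
      linarith
    _ = _ := by
      field_simp

/-! ### Equidistribution against monomials -/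

/-- Equidistribution of a sequence of Bourgain harmonics against the test function `f`. -/
def Equidistributes (σ : ℕ → ℕ → ℤ) (k : ℕ → ℕ) (f : S3 → ℂ) : Prop :=
  Tendsto (fun N : ℕ => ∫ q, f q * ((‖bourgainHarmonic (σ N) N (k N) q‖ ^ 2 : ℝ) : ℂ) ∂S3.vol)
    atTop (𝓝 (∫ q, f q ∂S3.vol))

theorem equidistributes_offDiagonal {σ : ℕ → ℕ → ℤ} (hσ : ∀ N, IsRudinShapiro N (σ N))
    (k : ℕ → ℕ) {r : ℕ} (hr : 1 ≤ r) (b c : ℕ) :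
    Equidistributes σ k fun q => mixedMonomial (b + r) b c (c + r) (S3.z q) (S3.w q) := by
  obtain ⟨C, hC⟩ := exists_abs_sum_mul_shift_le r hr
  rw [Equidistributes, S3.integral_mixedMonomial, if_neg (by omega)]
  have h := (tendsto_natLog_div_atTop.const_mul
    (2 * ((b + 1 : ℝ) ^ b * (c + 1) ^ (c + r)) * C))
  rw [mul_zero] at h
  -- For `N ≥ r` one may write `N = n + r`, as the off-diagonal estimate requires.
  refine squeeze_zero_norm' ((eventually_ge_atTop r).mono fun N hN => ?_) h
  obtain ⟨n, rfl⟩ := Nat.exists_eq_add_of_le' hN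
  refine (norm_integral_offDiagonal_le (M := C * (Nat.log 2 (3 * (n + r) + 1) + 1))
    fun m hm => ?_).trans (le_of_eq ?_)
  · exact_mod_cast hC (n + r) _ (hσ _) m (by omega)
  · ring

/-- Every `|P_{N,k}|²` is invariant under the common rotation of `z` and `w`, whereas the monomial
has nonzero weight; both integrals vanish for every `N`. -/
theorem equidistributes_of_add_ne {σ : ℕ → ℕ → ℤ} (k : ℕ → ℕ) {a b c d : ℕ} (h : a + c ≠ b + d) :
    Equidistributes σ k fun q => mixedMonomial a b c d (S3.z q) (S3.w q) := by
  rw [Equidistributes, S3.integral_mixedMonomial, if_neg (by omega)]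
  refine tendsto_const_nhds.congr fun N => ?_
  rw [integral_mixedMonomial_mul_bourgainHarmonic]
  symm
  rw [Finset.sum_eq_zero, mul_zero]
  refine fun j hj => Finset.sum_eq_zero fun l hl => ?_
  have hj' := Finset.mem_range.1 hj
  have hl' := Finset.mem_range.1 hl
  rw [if_neg (by omega), mul_zero]

theorem Equidistributes.star {σ : ℕ → ℕ → ℤ} {k : ℕ → ℕ} {f : S3 → ℂ}
    (h : Equidistributes σ k f) : Equidistributes σ k fun q => star (f q) := by
  have h1 := (Complex.continuous_conj.tendsto _).comp h
  rw [← integral_conj] at h1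
  refine h1.congr fun N => ?_
  rw [Function.comp_apply, ← integral_conj]
  simp only [map_mul, Complex.conj_ofReal, Complex.star_def]

theorem star_mixedMonomial (a b c d : ℕ) (x y : ℂ) :
    star (mixedMonomial a b c d x y) = mixedMonomial b a d c x y := by
  simp only [mixedMonomial, star_mul', star_pow, star_star]
  ring

theorem equidistributes_mixedMonomial {σ : ℕ → ℕ → ℤ} (hσ : ∀ N, IsRudinShapiro N (σ N))
    (k : ℕ → ℕ) (a b c d : ℕ) :
    Equidistributes σ k fun q => mixedMonomial a b c d (S3.z q) (S3.w q) := by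
  by_cases h : a + c = b + d
  · rcases lt_trichotomy a b with hab | rfl | hab
    -- Conjugation exchanges `a` with `b` and `c` with `d`, reducing to the case `a > b`.
    · obtain ⟨r, rfl⟩ := Nat.exists_eq_add_of_le hab.le
      obtain rfl : c = d + r := by omega
      simpa only [star_mixedMonomial] using
        (equidistributes_offDiagonal hσ k (r := r) (by omega) a d).star
    · obtain rfl : c = d := by omega
      exact tendsto_const_nhds.congr fun N =>
        (integral_diagonal_mul_bourgainHarmonic (hσ N) (k N) a c).symm
    · obtain ⟨r, rfl⟩ := Nat.exists_eq_add_of_le hab.le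
      obtain rfl : d = c + r := by omega
      exact equidistributes_offDiagonal hσ k (by omega) b c
  · exact equidistributes_of_add_ne k h

theorem continuous_bourgainHarmonic (σ : ℕ → ℤ) (N k : ℕ) :
    Continuous (bourgainHarmonic σ N k) := by
  have := S3.continuous_z
  have := S3.continuous_w
  unfold bourgainHarmonic
  fun_prop

theorem continuous_mul_norm_sq_bourgainHarmonic {f : S3 → ℂ} (hf : Continuous f) (σ : ℕ → ℤ)
    (N k : ℕ) : Continuous fun q => f q * ((‖bourgainHarmonic σ N k q‖ ^ 2 : ℝ) : ℂ) := by
  have := continuous_bourgainHarmonic σ N k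
  fun_prop

theorem Equidistributes.add {σ : ℕ → ℕ → ℤ} {k : ℕ → ℕ} {f g : S3 → ℂ} (hf : Continuous f)
    (hg : Continuous g) (h1 : Equidistributes σ k f) (h2 : Equidistributes σ k g) :
    Equidistributes σ k fun q => f q + g q := by
  rw [Equidistributes, integral_add (S3.integrable_of_continuous hf)
    (S3.integrable_of_continuous hg)]
  refine (Tendsto.add h1 h2).congr fun N => ?_
  rw [← integral_add
    (S3.integrable_of_continuous (continuous_mul_norm_sq_bourgainHarmonic hf _ _ _))
    (S3.integrable_of_continuous (continuous_mul_norm_sq_bourgainHarmonic hg _ _ _))]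
  simp only [add_mul]

theorem Equidistributes.const_mul {σ : ℕ → ℕ → ℤ} {k : ℕ → ℕ} {f : S3 → ℂ} (x : ℂ)
    (h : Equidistributes σ k f) : Equidistributes σ k fun q => x * f q := by
  rw [Equidistributes, integral_const_mul]
  refine (Tendsto.const_mul x h).congr fun N => ?_
  rw [← integral_const_mul]
  simp only [mul_assoc]

/-! ### Passage to continuous functions by density -/

/-- The star subalgebra of `C(S³, ℂ)` generated by the complex coordinates. -/
noncomputable def S3.polynomialFunctions : StarSubalgebra ℂ C(S3, ℂ) :=
  StarAlgebra.adjoin ℂ {⟨S3.z, S3.continuous_z⟩, ⟨S3.w, S3.continuous_w⟩}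

theorem S3.separatesPoints_polynomialFunctions : S3.polynomialFunctions.SeparatesPoints := by
  intro p q hpq
  have hz : (⟨S3.z, S3.continuous_z⟩ : C(S3, ℂ)) ∈ S3.polynomialFunctions :=
    StarAlgebra.subset_adjoin ℂ _ (by simp)
  have hw : (⟨S3.w, S3.continuous_w⟩ : C(S3, ℂ)) ∈ S3.polynomialFunctions :=
    StarAlgebra.subset_adjoin ℂ _ (by simp)
  by_contra! h
  have h1 : S3.z p = S3.z q := h _ ⟨_, hz, rfl⟩
  have h2 : S3.w p = S3.w q := h _ ⟨_, hw, rfl⟩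
  refine hpq (Subtype.ext (complexCoords.injective ?_))
  rw [S3.complexCoords_coe, S3.complexCoords_coe, h1, h2]

theorem S3.exists_mixedMonomial_of_mem_closure {f : C(S3, ℂ)}
    (hf : f ∈ Submonoid.closure (({⟨S3.z, S3.continuous_z⟩, ⟨S3.w, S3.continuous_w⟩} :
      Set C(S3, ℂ)) ∪ star {⟨S3.z, S3.continuous_z⟩, ⟨S3.w, S3.continuous_w⟩})) :
    ∃ a b c d, ∀ q, f q = mixedMonomial a b c d (S3.z q) (S3.w q) := by
  induction hf using Submonoid.closure_induction with
  | mem x hx =>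
    rcases hx with (rfl | rfl) | (hx | hx)
    · exact ⟨1, 0, 0, 0, fun q => by simp [mixedMonomial]⟩
    · exact ⟨0, 0, 1, 0, fun q => by simp [mixedMonomial]⟩
    · obtain rfl := star_eq_iff_star_eq.1 hx
      exact ⟨0, 1, 0, 0, fun q => by simp [mixedMonomial]⟩
    · obtain rfl := star_eq_iff_star_eq.1 hx
      exact ⟨0, 0, 0, 1, fun q => by simp [mixedMonomial]⟩
  | one => exact ⟨0, 0, 0, 0, fun q => by simp [mixedMonomial]⟩
  | mul x y _ _ hx hy =>
    obtain ⟨a, b, c, d, hx⟩ := hx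
    obtain ⟨a', b', c', d', hy⟩ := hy
    exact ⟨_, _, _, _, fun q => by rw [ContinuousMap.mul_apply, hx, hy, mixedMonomial_mul]⟩

theorem equidistributes_polynomialFunctions {σ : ℕ → ℕ → ℤ} (hσ : ∀ N, IsRudinShapiro N (σ N))
    (k : ℕ → ℕ) {f : C(S3, ℂ)} (hf : f ∈ S3.polynomialFunctions) : Equidistributes σ k f := by
  replace hf : f ∈ Submodule.span ℂ (Submonoid.closure (({⟨S3.z, S3.continuous_z⟩,
      ⟨S3.w, S3.continuous_w⟩} : Set C(S3, ℂ)) ∪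
      star {⟨S3.z, S3.continuous_z⟩, ⟨S3.w, S3.continuous_w⟩}) : Set C(S3, ℂ)) := by
    -- The star algebra generated by a set is the algebra generated by the set and its adjoints,
    -- hence the span of their products, which are monomials.
    rw [← Algebra.adjoin_eq_span]
    exact hf
  induction hf using Submodule.span_induction with
  | mem x hx =>
    obtain ⟨a, b, c, d, h⟩ := S3.exists_mixedMonomial_of_mem_closure hx
    rw [show (x : S3 → ℂ) = _ from funext h]
    exact equidistributes_mixedMonomial hσ k a b c d
  | zero => simp [Equidistributes]
  | add x y _ _ hx hy => exact hx.add x.continuous y.continuous hy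
  | smul t x _ hx => exact hx.const_mul t

/-- Since `|P_{N,k}|²` is a probability density, the error is uniform in `N`, as the density
argument requires. -/
theorem dist_integral_mul_bourgainHarmonic_le {σ : ℕ → ℤ} {N : ℕ} (hσ : IsRudinShapiro N σ)
    (k : ℕ) (f g : C(S3, ℂ)) :
    dist (∫ q, f q * ((‖bourgainHarmonic σ N k q‖ ^ 2 : ℝ) : ℂ) ∂S3.vol)
      (∫ q, g q * ((‖bourgainHarmonic σ N k q‖ ^ 2 : ℝ) : ℂ) ∂S3.vol) ≤ dist f g := by
  have hP := continuous_bourgainHarmonic σ N k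
  rw [dist_eq_norm, ← integral_sub
    (S3.integrable_of_continuous (continuous_mul_norm_sq_bourgainHarmonic f.continuous _ _ _))
    (S3.integrable_of_continuous (continuous_mul_norm_sq_bourgainHarmonic g.continuous _ _ _))]
  have hint : Integrable (fun q => dist f g * ‖bourgainHarmonic σ N k q‖ ^ 2) S3.vol :=
    Continuous.integrable_of_hasCompactSupport (by fun_prop) (.of_compactSpace _)
  refine (norm_integral_le_of_norm_le hint (.of_forall fun q => ?_)).trans_eq ?_
  · rw [← sub_mul, norm_mul, Complex.norm_real, Real.norm_of_nonneg (by positivity)]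
    gcongr
    rw [← dist_eq_norm]
    exact ContinuousMap.dist_apply_le_dist q
  · rw [integral_const_mul, integral_norm_sq_bourgainHarmonic hσ, mul_one]

theorem dist_integral_vol_le (f g : C(S3, ℂ)) :
    dist (∫ q, f q ∂S3.vol) (∫ q, g q ∂S3.vol) ≤ dist f g := by
  rw [dist_eq_norm, ← integral_sub (S3.integrable_of_continuous f.continuous)
    (S3.integrable_of_continuous g.continuous)]
  refine (norm_integral_le_of_norm_le_const (C := dist f g) (.of_forall fun q => ?_)).trans_eq ?_
  · rw [← dist_eq_norm]
    exact ContinuousMap.dist_apply_le_dist q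
  · simp

theorem equidistributes_of_continuous {σ : ℕ → ℕ → ℤ} (hσ : ∀ N, IsRudinShapiro N (σ N))
    (k : ℕ → ℕ) (f : C(S3, ℂ)) : Equidistributes σ k f := by
  have hf : f ∈ S3.polynomialFunctions.topologicalClosure := by
    rw [ContinuousMap.starSubalgebra_topologicalClosure_eq_top_of_separatesPoints _
      S3.separatesPoints_polynomialFunctions]
    trivial
  refine Metric.tendsto_atTop.2 fun ε hε => ?_
  obtain ⟨g, hg, hfg⟩ := Metric.mem_closure_iff.1 hf (ε / 3) (by positivity)
  obtain ⟨N₀, hN₀⟩ := Metric.tendsto_atTop.1 (equidistributes_polynomialFunctions hσ k hg) (ε / 3)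
    (by positivity)
  refine ⟨N₀, fun N hN => ?_⟩
  have h1 := dist_integral_mul_bourgainHarmonic_le (hσ N) (k N) f g
  have h2 := hN₀ N hN
  have h3 := dist_integral_vol_le g f
  rw [dist_comm g f] at h3
  have h4 := dist_triangle4
    (∫ q, f q * ((‖bourgainHarmonic (σ N) N (k N) q‖ ^ 2 : ℝ) : ℂ) ∂S3.vol)
    (∫ q, g q * ((‖bourgainHarmonic (σ N) N (k N) q‖ ^ 2 : ℝ) : ℂ) ∂S3.vol)
    (∫ q, g q ∂S3.vol) (∫ q, f q ∂S3.vol)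
  linarith

theorem mainTheorem2 (f : S3 → ℂ) (hf : ContMDiff (𝓡 3) 𝓘(ℝ, ℂ) ∞ f)
    (σ : ℕ → ℕ → ℤ) (hσ : ∀ N, IsRudinShapiro N (σ N))
    (k : ℕ → ℕ) (hk : ∀ N, k N ≤ N) :
    Tendsto (fun N : ℕ => ∫ q, f q * ((‖bourgainHarmonic (σ N) N (k N) q‖ ^ 2 : ℝ) : ℂ) ∂S3.vol)
      atTop (𝓝 (∫ q, f q ∂S3.vol)) :=
  equidistributes_of_continuous hσ k ⟨f, hf.continuous⟩
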